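/- Fix integers $k,T\ge 0$, reals $\varepsilon,\delta\ge 0$, $\beta$ and $\eta>0$. \emph{Threshold problem.} An algorithm $\mathcal A$ receives in advance a data set $S$ of $k$ points of $[0,1]$ (a multiset), and then $T$ online queries $q_1\le\dots\le q_T$ in $[0,1]$; it answers each query with $\bot$ or $\top$ before seeing the next one, and halts at its first $\top$. With $c_i$ the number of points of $S$ that are at most $q_i$, the answer to $q_i$ must be $\bot$ if $c_i\le k/2$ and $\top$ if $c_i\ge k$; otherwise it is free. Data sets are adjacent if one arises from the other by replacing one point. \emph{Threshold monitor (counter) problem.} An algorithm $\mathcal B$ receives online updates $\Delta_1,\dots,\Delta_T\in\{0,1\}$; after each update $\Delta_t$ it answers $\bot$ or $\top$, and it halts at its first $\top$. With $n_t=\sum_{j\le t}\Delta_j$, the answer must be $\bot$ if $n_t<k/2$ and $\top$ if $n_t\ge k$; otherwise it is free. Update sequences are adjacent if they differ in at most one position. An algorithm has failure probability at most $\beta$ if on every input (data set together with a nondecreasing query sequence, respectively update sequence) all answers given up to and including the halting round are correct with probability at least $1-\beta$. It is $(\varepsilon,\delta)$-DP if for all adjacent inputs (data sets with the same query sequence,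 respectively update sequences), and every set $E$ of transcripts, the transcript probabilities $P,P'$ satisfy $P(E)\le e^{\varepsilon}P'(E)+\delta$. \textbf{Theorem.} Let $\mathcal A$ be an $(\varepsilon,\delta)$-DP algorithm for the threshold problem with $k$ data points and $T$ queries, with failure probability at most $\beta$. Then for every $\eta>0$ there are points $0<x_1<\dots<x_T\le 1$ and numbers $r_i(D)\in[0,1]$, for $1\le i\le T$ and finite $D\subseteq[0,1]$, such that the following hold. \begin{enumerate} \item For every $S\subseteq\{x_1,\dots,x_T\}$ with $|S|=k$ and every $i$ such that, on data set $S$ and queries $x_1,\dots,x_T$, $\mathcal A$ has positive probability of not halting before query $i$, \[\bigl|\,r_i(S\cap[0,x_i])-\Pr[\mathcal A(S)\text{ answers }\top\text{ to query }i\mid \mathcal A(S)\text{ did not halt before}]\,\bigr|\le\eta .\] \item There is an algorithm $\mathcal B$ for the threshold monitor problem with threshold $k$ and $T$ updates which, whenever it is still running in round $i$ and $\sum_{j\le i}\Delta_j\le k$, answers $\top$ in that round with conditional probability $r_i(\{x_j: j\le i,\ \Delta_j=1\})$, and which is $(\varepsilon,\delta+T\eta)$-DP and has failure probability at most $\beta+T\eta$.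 \end{enumerate} -/

import Mathlib

open scoped unitInterval

noncomputable section

namespace OnlineThreshold

/-- The outcome of a `T`-round execution in which each response is `⊥` or `⊤` and the algorithm
halts at its first `⊤`: `some t` means that `⊤` is reported in round `t` (and `⊥` in every earlier
round), `none` means that all `T` responses are `⊥`.  This is the whole transcript. -/
abbrev Outcome (T : ℕ) : Type := Option (Fin T)

/-- The algorithm reports `⊤` in round `t`. -/
def Outcome.ReportsTop {T : ℕ} (o : Outcome T) (t : Fin T) : Prop := o = some t

/-- The algorithm reports `⊥` in round `t` (so it halts strictly later, or never). -/
def Outcome.ReportsBot {T : ℕ} (o : Outcome T) (t : Fin T) : Prop := ∀ s, o = some s → t < s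

/-- Probability of an event, as a real number. -/
def prob {Ω : Type} (p : PMF Ω) (E : Set Ω) : ℝ := (p.toOuterMeasure E).toReal

/-- Probability that `⊤` is reported in round `t`. -/
def haltProb {T : ℕ} (p : PMF (Outcome T)) (t : Fin T) : ℝ := prob p {o | o.ReportsTop t}

/-- Probability that the algorithm did not halt before round `t`. -/
def aliveProb {T : ℕ} (p : PMF (Outcome T)) (t : Fin T) : ℝ :=
  prob p {o | ∀ s, s < t → o.ReportsBot s}

/-- `(ε, δ)`-indistinguishability, in the direction from `p` to `p'`. -/
def DPClose {Ω : Type} (ε δ : ℝ) (p p' : PMF Ω) : Prop :=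
  ∀ E : Set Ω, prob p E ≤ Real.exp ε * prob p' E + δ

/-! ### The online threshold problem -/

/-- A randomized algorithm that receives a data set of `k` points of `[0,1]` (a multiset) in advance
and then answers `T` online queries `q₁ ≤ … ≤ q_T` in `[0,1]`, halting at its first `⊤`.  It is
described by the law of its transcript on every input; being online means that whether it halts in
round `t` is not influenced by later queries. -/
structure ThresholdAlg (k T : ℕ) where
  run : Sym I k → (Fin T →o I) → PMF (Outcome T)
  online : ∀ (S : Sym I k) (q q' : Fin T →o I) (t : Fin T),
    (∀ s ≤ t, q s = q' s) → run S q (some t) = run S q' (some t)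

/-- Two data sets of the same size are adjacent if one point is replaced by another. -/
def DataAdjacent {k : ℕ} (S S' : Sym I k) : Prop :=
  ∃ (m : Multiset I) (a b : I), (S : Multiset I) = a ::ₘ m ∧ (S' : Multiset I) = b ::ₘ m

/-- Differential privacy of the whole transcript with respect to the data set. -/
def ThresholdAlg.IsDP {k T : ℕ} (A : ThresholdAlg k T) (ε δ : ℝ) : Prop :=
  ∀ (q : Fin T →o I) (S S' : Sym I k), DataAdjacent S S' → DPClose ε δ (A.run S q) (A.run S' q)

/-- Number of data points that are at most `z`. -/
def rankBelow {k : ℕ} (S : Sym I k) (z : I) : ℕ := (S : Multiset I).countP (fun y => y ≤ z)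

/-- All responses are correct: with `c` the number of data points at most the query, `⊥` is required
if `c ≤ k/2`, and `⊤` is required if `c ≥ k`. -/
def ThresholdSucceeds {k T : ℕ} (S : Sym I k) (q : Fin T →o I) (o : Outcome T) : Prop :=
  ∀ t : Fin T,
    (o.ReportsTop t → ¬ ((rankBelow S (q t) : ℝ) ≤ (k : ℝ) / 2)) ∧
    (o.ReportsBot t → ¬ (k ≤ rankBelow S (q t)))

/-- On every data set and query sequence, the algorithm fails with probability at most `β`. -/
def ThresholdAlg.FailsAtMost {k T : ℕ} (A : ThresholdAlg k T) (β : ℝ) : Prop :=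
  ∀ (S : Sym I k) (q : Fin T →o I), prob (A.run S q) {o | ¬ ThresholdSucceeds S q o} ≤ β

/-! ### The online threshold monitor (counter) problem -/

/-- A randomized algorithm that receives `T` updates in `{0,1}` one at a time, responds after each of
them, and halts at its first `⊤`.  Being online means that whether it halts in round `t` is not
influenced by later updates. -/
structure MonitorAlg (T : ℕ) where
  run : (Fin T → Bool) → PMF (Outcome T)
  online : ∀ (Δ Δ' : Fin T → Bool) (t : Fin T),
    (∀ s ≤ t, Δ s = Δ' s) → run Δ (some t) = run Δ' (some t)

/-- Two update sequences are adjacent if they differ in at most one update. -/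
def UpdatesAdjacent {T : ℕ} (Δ Δ' : Fin T → Bool) : Prop :=
  ∃ j : Fin T, ∀ i : Fin T, i ≠ j → Δ i = Δ' i

/-- Differential privacy of the whole transcript with respect to the update sequence. -/
def MonitorAlg.IsDP {T : ℕ} (B : MonitorAlg T) (ε δ : ℝ) : Prop :=
  ∀ Δ Δ' : Fin T → Bool, UpdatesAdjacent Δ Δ' → DPClose ε δ (B.run Δ) (B.run Δ')

/-- The rounds up to and including `t` whose update is `1`. -/
def onesUpTo {T : ℕ} (Δ : Fin T → Bool) (t : Fin T) : Finset (Fin T) :=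
  Finset.univ.filter (fun j => j ≤ t ∧ Δ j = true)

/-- All responses are correct for threshold `k`: with `n` the number of ones so far, `⊥` is required
if `n < k/2`, and `⊤` is required if `n ≥ k`. -/
def MonitorSucceeds {T : ℕ} (k : ℕ) (Δ : Fin T → Bool) (o : Outcome T) : Prop :=
  ∀ t : Fin T,
    (o.ReportsTop t → ¬ (((onesUpTo Δ t).card : ℝ) < (k : ℝ) / 2)) ∧
    (o.ReportsBot t → ¬ (k ≤ (onesUpTo Δ t).card))

/-- On every update sequence, the algorithm fails (for threshold `k`) with probability at most
`β`. -/
def MonitorAlg.FailsAtMost {T : ℕ} (B : MonitorAlg T) (k : ℕ) (β : ℝ) : Prop :=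
  ∀ Δ : Fin T → Bool, prob (B.run Δ) {o | ¬ MonitorSucceeds k Δ o} ≤ β

/-! ### Oblivious halting probabilities -/

/-- On data sets `S ⊆ {x₁ < … < x_T}` of size `k` and queries `x₁, …, x_T`, the probability that `A`
reports `⊤` on the `i`-th query, conditioned on not having halted before (whenever that event has
positive probability), is within `η` of `r i (S ∩ [0, x_i])`. -/
def HaltsObliviously {k T : ℕ} (A : ThresholdAlg k T) (η : ℝ) (x : Fin T ↪o I)
    (r : Fin T → Finset I → ℝ) : Prop :=
  (∀ i D, r i D ∈ Set.Icc (0 : ℝ) 1) ∧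
  ∀ (S : Finset I) (hS : S.card = k), (S : Set I) ⊆ Set.range x → ∀ i : Fin T,
    0 < aliveProb (A.run ⟨S.val, hS⟩ x.toOrderHom) i →
    |r i (S.filter (fun y => y ≤ x i)) -
      haltProb (A.run ⟨S.val, hS⟩ x.toOrderHom) i /
        aliveProb (A.run ⟨S.val, hS⟩ x.toOrderHom) i| ≤ η

/-- As long as at most `k` ones have arrived, `B`, if still running in round `i`, reports `⊤` with
conditional probability `r i {x_j : j ≤ i, Δ_j = 1}`. -/
def HaltsAccordingTo {T : ℕ} (B : MonitorAlg T) (k : ℕ) (x : Fin T ↪o I)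
    (r : Fin T → Finset I → ℝ) : Prop :=
  ∀ (Δ : Fin T → Bool) (i : Fin T), (onesUpTo Δ i).card ≤ k →
    haltProb (B.run Δ) i =
      r i ((onesUpTo Δ i).map x.toEmbedding) * aliveProb (B.run Δ) i

end OnlineThreshold

end

noncomputable section

namespace OnlineThreshold

/-! ### Prefix-determined colourings along a sequence of natural numbers -/

/-! A counter would like to run `A` on the points of the rounds whose update is 1. But `A` needs its
whole data set in advance, and its decision at query `x_i` may depend on data points beyond `x_i`. A
Ramsey argument removes this dependence: on suitable points the hazard rate, i.e. the conditional
probability of halting in round `i`, is nearly a function of `S ∩ [0, x_i]`. Hazards are rounded at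
scale `γ` to give finitely many colours, and the points are chosen one by one, generically for a
free ultrafilter, so that every data point beyond `x_i` can be traded for a limit
(`iterLim_image_union`, `exists_strictMono_colour_eq`). Being online is essential: the colouring for
round `i` involves only the queries up to `i`, which are fixed before the later points are chosen.

In each round the monitor pads the ones seen so far with points beyond all queries and halts at the
hazard rate of `A` on that set. It is compared with `A` on the first `k` ones of the full update
sequence, padded likewise (`onesData`). The hazards differ by at most `γ` in each round, so the laws
differ by at most `2Tγ` on every event (`abs_prob_sub_le_of_hazard`). Changing one update replaces
at most one data point (`firstOf_eq_or_replace`), so privacy transfers. Correctness transfers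
because the rank of a query is at most the number of ones so far, and equals `k` once that number
reaches `k`. -/

lemma exists_seq_of_forall_prefix {α : Type*} [Inhabited α] (P : (ℕ → α) → ℕ → α → Prop)
    (hex : ∀ y j, ∃ a, P y j a)
    (hloc : ∀ y y' j a, (∀ i < j, y i = y' i) → P y j a → P y' j a) :
    ∃ y : ℕ → α, ∀ j, P y j (y j) := by
  choose next hnext using hex
  -- Values from `j` on are filled with `default`; by `hloc` the choice at `j` does not see them.
  let y : ℕ → α := fun j => Nat.strongRecOn j fun j ih =>
    next (fun i => if h : i < j then ih i h else default) j
  have hy : ∀ j, y j = next (fun i => if i < j then y i else default) j := by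
    intro j
    simp only [y]
    rw [Nat.strongRecOn_eq]
    simp
  refine ⟨y, fun j => ?_⟩
  have h := hnext (fun i => if i < j then y i else default) j
  rw [← hy] at h
  exact hloc _ _ _ _ (fun i hi => by simp [hi]) h

section Colouring

variable {C : Type*} [Finite C]

lemma exists_hyperfilter_eventually_eq (g : ℕ → C) :
    ∃ c, ∀ᶠ n in (Filter.hyperfilter ℕ : Filter ℕ), g n = c :=
  Ultrafilter.eventually_exists_iff.1 (Filter.Eventually.of_forall fun n => ⟨g n, rfl⟩)

/-- The limit of a finite colouring of `ℕ` along the hyperfilter. -/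
def ultraLim (g : ℕ → C) : C := (exists_hyperfilter_eventually_eq g).choose

lemma eventually_eq_ultraLim (g : ℕ → C) :
    ∀ᶠ n in (Filter.hyperfilter ℕ : Filter ℕ), g n = ultraLim g :=
  (exists_hyperfilter_eventually_eq g).choose_spec

/-- The iterated limit of `G (s ∪ {n₁, …, n_m})` along the hyperfilter. -/
def iterLim (G : Finset ℕ → C) : ℕ → Finset ℕ → C
  | 0, s => G s
  | m + 1, s => ultraLim fun n => iterLim G m (insert n s)

/-- Peel off the largest index of `R`: its point was chosen so that inserting it into a set of
earlier points amounts to taking one more limit. Only indices beyond `i` can be peeled, so `D`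
stays. -/
lemma iterLim_image_union {G : Finset ℕ → C} {y : ℕ → ℕ} {i k : ℕ}
    (hy : ∀ j, i < j → ∀ s ⊆ (Finset.range j).image y, ∀ m < k,
      iterLim G m (insert (y j) s) = iterLim G (m + 1) s)
    {D : Finset ℕ} (hD : ∀ a ∈ D, a ≤ i) (R : Finset ℕ) (hR : ∀ a ∈ R, i < a) (m : ℕ)
    (hm : m + R.card ≤ k) :
    iterLim G m ((D ∪ R).image y) = iterLim G (m + R.card) (D.image y) := by
  induction R using Finset.induction_on_max generalizing m with
  | empty => simp
  | insert a s hs ih =>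
    have ha : a ∉ s := fun h => lt_irrefl _ (hs a h)
    rw [Finset.card_insert_of_notMem ha] at hm ⊢
    have hia := hR a (Finset.mem_insert_self a s)
    rw [Finset.union_insert, Finset.image_insert, hy a hia _ _ m (by omega),
      ih (fun b hb => hR b (Finset.mem_insert_of_mem hb)) (m + 1) (by omega)]
    · congr 1
      omega
    · refine Finset.image_subset_image fun b hb => Finset.mem_range.2 ?_
      rcases Finset.mem_union.1 hb with h | h
      · exact (hD b h).trans_lt hia
      · exact hs b h

/-- If each colouring `G y i` of finite sets is determined by `y 0, …, y i`, some strictly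
increasing `y` makes the colour of `{y j | j ∈ J}` with `J.card = k` depend only on `J ∩ [0, i]`. -/
lemma exists_strictMono_colour_eq (k : ℕ) (G : (ℕ → ℕ) → ℕ → Finset ℕ → C)
    (hloc : ∀ y y' i, (∀ s ≤ i, y s = y' s) → G y i = G y' i) :
    ∃ y : ℕ → ℕ, StrictMono y ∧ ∀ (i : ℕ) (J J' : Finset ℕ), J.card = k → J'.card = k →
      J.filter (· ≤ i) = J'.filter (· ≤ i) → G y i (J.image y) = G y i (J'.image y) := by
  -- When `y j` is chosen, `G y i` is already determined for every `i < j`. The bounds on `i`, `s`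
  -- and `m` leave finitely many requirements, each true for ultrafilter-almost every value, so one
  -- value meets them all.
  have hseq : ∃ y : ℕ → ℕ, ∀ j, (∀ i < j, y i < y j) ∧
      ∀ i < j, ∀ s ⊆ (Finset.range j).image y, ∀ m < k,
        iterLim (G y i) m (insert (y j) s) = iterLim (G y i) (m + 1) s := by
    refine exists_seq_of_forall_prefix
      (fun y j a => (∀ i < j, y i < a) ∧ ∀ i < j, ∀ s ⊆ (Finset.range j).image y, ∀ m < k,
        iterLim (G y i) m (insert a s) = iterLim (G y i) (m + 1) s) ?_ ?_
    · intro y j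
      refine Filter.Eventually.exists (f := (Filter.hyperfilter ℕ : Filter ℕ)) ?_
      have h₁ : ∀ᶠ a in (Filter.hyperfilter ℕ : Filter ℕ), ∀ i ∈ Finset.range j, y i < a :=
        (Filter.eventually_all_finset _).2 fun i _ =>
          Nat.hyperfilter_le_atTop (Filter.eventually_gt_atTop (y i))
      have h₂ : ∀ᶠ a in (Filter.hyperfilter ℕ : Filter ℕ), ∀ i ∈ Finset.range j,
          ∀ s ∈ ((Finset.range j).image y).powerset, ∀ m ∈ Finset.range k,
            iterLim (G y i) m (insert a s) = iterLim (G y i) (m + 1) s :=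
        (Filter.eventually_all_finset _).2 fun i _ => (Filter.eventually_all_finset _).2 fun s _ =>
          (Filter.eventually_all_finset _).2 fun m _ => eventually_eq_ultraLim _
      filter_upwards [h₁, h₂] with a ha₁ ha₂
      simp only [Finset.mem_range, Finset.mem_powerset] at ha₁ ha₂
      exact ⟨ha₁, ha₂⟩
    · rintro y y' j a hyy ⟨h₁, h₂⟩
      have himg : (Finset.range j).image y = (Finset.range j).image y' :=
        Finset.image_congr fun i hi => hyy i (by simpa using hi)
      refine ⟨fun i hi => hyy i hi ▸ h₁ i hi, fun i hi => ?_⟩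
      rw [← himg, ← hloc y y' i fun s hs => hyy s (hs.trans_lt hi)]
      exact h₂ i hi
  obtain ⟨y, hy⟩ := hseq
  refine ⟨y, fun i j hij => (hy j).1 i hij, fun i J J' hJ hJ' h => ?_⟩
  have key : ∀ J : Finset ℕ, J.card = k → G y i (J.image y) =
      iterLim (G y i) (k - (J.filter (· ≤ i)).card) ((J.filter (· ≤ i)).image y) := by
    intro J hJ
    have hsplit := Finset.card_filter_add_card_filter_not (s := J) (· ≤ i)
    have := iterLim_image_union (G := G y i) (k := k) (fun j hj => (hy j).2 i hj)
      (D := J.filter (· ≤ i)) (by simp) (J.filter (¬ · ≤ i)) (by simp) 0 (by omega)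
    rw [Finset.filter_union_filter_not_eq] at this
    rw [show k - (J.filter (· ≤ i)).card = 0 + (J.filter (¬ · ≤ i)).card by omega, ← this]
    rfl
  rw [key J hJ, key J' hJ', h]

end Colouring

/-! ### Laws of outcomes and their hazard rates -/

lemma prob_eq_sum {Ω : Type} [Fintype Ω] (p : PMF Ω) (E : Set Ω) :
    prob p E = ∑ o, E.indicator (fun o => (p o).toReal) o := by
  classical
  rw [prob, PMF.toOuterMeasure_apply_fintype, ENNReal.toReal_sum]
  · refine Finset.sum_congr rfl fun o _ => ?_
    by_cases h : o ∈ E <;> simp [h]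
  · intro o _
    by_cases h : o ∈ E <;> simp [h, p.apply_ne_top]

lemma sum_toReal_eq_one {Ω : Type} [Fintype Ω] (p : PMF Ω) : ∑ o, (p o).toReal = 1 := by
  rw [← ENNReal.toReal_sum fun o _ => p.apply_ne_top o, ← tsum_fintype (L := .unconditional _),
    p.tsum_coe, ENNReal.toReal_one]

lemma prob_nonneg {Ω : Type} (p : PMF Ω) (E : Set Ω) : 0 ≤ prob p E := ENNReal.toReal_nonneg

lemma prob_mono {Ω : Type} [Fintype Ω] (p : PMF Ω) {E F : Set Ω} (h : E ⊆ F) :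
    prob p E ≤ prob p F := by
  rw [prob_eq_sum, prob_eq_sum]
  exact Finset.sum_le_sum fun o _ =>
    Set.indicator_le_indicator_of_subset h (fun _ => ENNReal.toReal_nonneg) o

lemma DPClose.rfl {Ω : Type} {ε δ : ℝ} (hε : 0 ≤ ε) (hδ : 0 ≤ δ) (p : PMF Ω) :
    DPClose ε δ p p := fun E => by
  nlinarith [prob_nonneg p E, Real.one_le_exp hε]

lemma DPClose.of_abs_sub_le {Ω : Type} {ε δ γ : ℝ} {p p' q q' : PMF Ω} (h : DPClose ε δ p p')
    (hq : ∀ E, |prob q E - prob p E| ≤ γ) (hq' : ∀ E, |prob q' E - prob p' E| ≤ γ) :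
    DPClose ε (δ + γ * (1 + Real.exp ε)) q q' := fun E => by
  have h₁ := (abs_le.1 (hq E)).2
  have h₂ := (abs_le.1 (hq' E)).1
  have h₃ := mul_le_mul_of_nonneg_left h₂ (Real.exp_pos ε).le
  have h₄ := h E
  nlinarith

variable {T : ℕ}

lemma haltProb_eq (p : PMF (Outcome T)) (t : Fin T) : haltProb p t = (p (some t)).toReal := by
  classical
  rw [haltProb, prob_eq_sum]
  simp [Set.indicator_apply, Outcome.ReportsTop]

lemma haltProb_nonneg (p : PMF (Outcome T)) (t : Fin T) : 0 ≤ haltProb p t := prob_nonneg _ _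

lemma aliveProb_nonneg (p : PMF (Outcome T)) (t : Fin T) : 0 ≤ aliveProb p t := prob_nonneg _ _

lemma toReal_none (p : PMF (Outcome T)) : (p none).toReal = 1 - ∑ t, haltProb p t := by
  have h := sum_toReal_eq_one p
  rw [Fintype.sum_option] at h
  simp only [haltProb_eq]
  linarith

lemma aliveProb_eq (p : PMF (Outcome T)) (t : Fin T) :
    aliveProb p t = 1 - ∑ s with s < t, haltProb p s := by
  classical
  have hset : {o : Outcome T | ∀ s, s < t → o.ReportsBot s} = {o | ∀ u, o = some u → t ≤ u} := by
    ext o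
    refine ⟨fun h u hu => not_lt.1 fun hut => lt_irrefl _ (h u hut u hu),
      fun h s hs u hu => hs.trans_le (h u hu)⟩
  rw [aliveProb, hset, prob_eq_sum, Fintype.sum_option]
  simp only [Set.indicator_apply, Set.mem_ofPred_eq, reduceCtorEq, false_implies, implies_true,
    if_true, Option.some.injEq, forall_eq', toReal_none, Finset.sum_filter, haltProb_eq]
  rw [sub_add, ← Finset.sum_sub_distrib]
  congr 1
  refine Finset.sum_congr rfl fun s _ => ?_
  by_cases h : t ≤ s
  · simp [h, not_lt.2 h]
  · simp [h, not_le.1 h]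

lemma haltProb_le_aliveProb (p : PMF (Outcome T)) (t : Fin T) : haltProb p t ≤ aliveProb p t := by
  refine prob_mono p fun o ho s hs u hu => ?_
  obtain rfl : t = u := Option.some.inj ((show o = some t from ho).symm.trans hu)
  exact hs

lemma aliveProb_le_one (p : PMF (Outcome T)) (t : Fin T) : aliveProb p t ≤ 1 := by
  rw [aliveProb_eq]
  linarith [Finset.sum_nonneg fun s (_ : s ∈ Finset.univ.filter (· < t)) => haltProb_nonneg p s]

/-- Two sequences of halting probabilities with approximately the same hazard rates. -/
lemma sum_abs_sub_le_of_hazard {f g ρ : ℕ → ℝ} {γ : ℝ} (n : ℕ)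
    (hρ : ∀ i < n, ρ i ∈ Set.Icc (0 : ℝ) 1)
    (hf : ∀ i < n, |f i - ρ i * (1 - ∑ s ∈ Finset.range i, f s)| ≤ γ)
    (hg : ∀ i < n, g i = ρ i * (1 - ∑ s ∈ Finset.range i, g s)) :
    ∑ i ∈ Finset.range n, |g i - f i| +
      |∑ i ∈ Finset.range n, g i - ∑ i ∈ Finset.range n, f i| ≤ n * (2 * γ) := by
  induction n with
  | zero => simp
  | succ n ih =>
    have ih := ih (fun i hi => hρ i (by omega)) (fun i hi => hf i (by omega))
      fun i hi => hg i (by omega)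
    have hn := n.lt_succ_self
    obtain ⟨h0, h1⟩ := hρ n hn
    have hfn := hf n hn
    rw [Finset.sum_range_succ, Finset.sum_range_succ g, Finset.sum_range_succ f, hg n hn]
    set F := ∑ i ∈ Finset.range n, f i
    set H := ∑ i ∈ Finset.range n, g i
    set d := f n - ρ n * (1 - F)
    have e₁ : ρ n * (1 - H) - f n = -(ρ n * (H - F)) - d := by simp only [d]; ring
    have e₂ : H + ρ n * (1 - H) - (F + f n) = (1 - ρ n) * (H - F) - d := by simp only [d]; ring
    -- The old gap `|H - F|` enters the new term with weight `ρ n` and the new cumulative gap with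
    -- weight `1 - ρ n`. The weights add up to 1, so errors accumulate by `2γ` per round instead of
    -- compounding.
    have b₁ : |ρ n * (1 - H) - f n| ≤ ρ n * |H - F| + γ := by
      rw [e₁]
      refine (abs_sub _ _).trans ?_
      rw [abs_neg, abs_mul, abs_of_nonneg h0]
      linarith
    have b₂ : |H + ρ n * (1 - H) - (F + f n)| ≤ (1 - ρ n) * |H - F| + γ := by
      rw [e₂]
      refine (abs_sub _ _).trans ?_
      rw [abs_mul, abs_of_nonneg (sub_nonneg.2 h1)]
      linarith
    push_cast
    linarith

lemma sum_fin_lt_eq_sum_range {n : ℕ} (f : Fin n → ℝ) (t : Fin n) :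
    ∑ s with s < t, f s = ∑ s ∈ Finset.range t, if h : s < n then f ⟨s, h⟩ else 0 := by
  refine Finset.sum_nbij (fun s => s.1) (fun s hs => ?_) (fun _ _ _ _ h => Fin.ext h)
    (fun s hs => ?_) fun s _ => by simp
  · simpa using hs
  · have hst : s < t := by simpa using hs
    exact ⟨⟨s, hst.trans t.2⟩,
      Finset.mem_coe.2 (Finset.mem_filter.2 ⟨Finset.mem_univ _, Fin.lt_def.2 hst⟩), rfl⟩

/-- Two laws of outcomes whose hazard rates differ by at most `γ` are close in total variation. -/
lemma abs_prob_sub_le_of_hazard {p q : PMF (Outcome T)} {ρ : Fin T → ℝ} {γ : ℝ}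
    (hρ : ∀ i, ρ i ∈ Set.Icc (0 : ℝ) 1)
    (hp : ∀ i, |haltProb p i - ρ i * aliveProb p i| ≤ γ)
    (hq : ∀ i, haltProb q i = ρ i * aliveProb q i) (E : Set (Outcome T)) :
    |prob q E - prob p E| ≤ T * (2 * γ) := by
  classical
  have key := sum_abs_sub_le_of_hazard (γ := γ)
    (f := fun n => if h : n < T then haltProb p ⟨n, h⟩ else 0)
    (g := fun n => if h : n < T then haltProb q ⟨n, h⟩ else 0)
    (ρ := fun n => if h : n < T then ρ ⟨n, h⟩ else 0) T ?_ ?_ ?_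
  · simp only [Finset.sum_range, Fin.is_lt, dite_true, Fin.eta] at key
    refine le_trans ?_ key
    rw [prob_eq_sum, prob_eq_sum, ← Finset.sum_sub_distrib]
    refine (Finset.abs_sum_le_sum_abs _ _).trans ?_
    have hb : ∀ o, |E.indicator (fun o => (q o).toReal) o - E.indicator (fun o => (p o).toReal) o|
        ≤ |(q o).toReal - (p o).toReal| := fun o => by
      by_cases ho : o ∈ E <;> simp [ho]
    refine (Finset.sum_le_sum fun o _ => hb o).trans ?_
    -- The outcome `none` contributes the difference of the total halting probabilities, the second
    -- summand in `key`.
    rw [Fintype.sum_option, toReal_none, toReal_none, sub_sub_sub_cancel_left, abs_sub_comm,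
      add_comm]
    simp only [haltProb_eq, le_refl]
  · intro i hi
    simpa [hi] using hρ ⟨i, hi⟩
  · intro i hi
    have := hp ⟨i, hi⟩
    rw [aliveProb_eq, sum_fin_lt_eq_sum_range] at this
    simpa [hi] using this
  · intro i hi
    have := hq ⟨i, hi⟩
    rw [aliveProb_eq, sum_fin_lt_eq_sum_range] at this
    simpa [hi] using this

/-- The conditional probability of halting in round `t`. -/
def hazard (p : PMF (Outcome T)) (t : Fin T) : ℝ := haltProb p t / aliveProb p t

lemma hazard_mem_Icc (p : PMF (Outcome T)) (t : Fin T) : hazard p t ∈ Set.Icc (0 : ℝ) 1 :=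
  ⟨div_nonneg (prob_nonneg _ _) (prob_nonneg _ _),
    div_le_one_of_le₀ (haltProb_le_aliveProb p t) (prob_nonneg _ _)⟩

lemma hazard_congr {p q : PMF (Outcome T)} {t : Fin T} (h : ∀ s ≤ t, p (some s) = q (some s)) :
    hazard p t = hazard q t := by
  rw [hazard, hazard, aliveProb_eq, aliveProb_eq]
  simp only [haltProb_eq]
  rw [h t le_rfl, Finset.sum_congr rfl fun s hs => by rw [h s (Finset.mem_filter.1 hs).2.le]]

lemma abs_haltProb_sub_le {p : PMF (Outcome T)} {t : Fin T} {ρ γ : ℝ}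
    (h : |ρ - hazard p t| ≤ γ) : |haltProb p t - ρ * aliveProb p t| ≤ γ := by
  have hm : haltProb p t = hazard p t * aliveProb p t := by
    -- In a round that is almost surely not reached the quotient is meaningless, but the halting
    -- probability vanishes too.
    rcases (aliveProb_nonneg p t).eq_or_lt with h0 | h0
    · rw [← h0, mul_zero]
      exact le_antisymm (h0.symm ▸ haltProb_le_aliveProb p t) (haltProb_nonneg p t)
    · exact (div_mul_cancel₀ _ h0.ne').symm
  rw [hm, ← sub_mul, abs_mul, abs_sub_comm, abs_of_nonneg (aliveProb_nonneg p t)]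
  nlinarith [abs_nonneg (ρ - hazard p t), aliveProb_le_one p t,
    (aliveProb_nonneg p t)]

/-- Weights of the outcomes of an execution with hazard rates `ρ`. -/
def hazardWeight (ρ : Fin T → ℝ) : Outcome T → ℝ
  | none => ∏ s, (1 - ρ s)
  | some t => ρ t * ∏ s with s < t, (1 - ρ s)

lemma hazardWeight_nonneg {ρ : Fin T → ℝ} (hρ : ∀ t, ρ t ∈ Set.Icc (0 : ℝ) 1) (o : Outcome T) :
    0 ≤ hazardWeight ρ o := by
  have h : ∀ s : Finset (Fin T), 0 ≤ ∏ t ∈ s, (1 - ρ t) := fun s =>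
    Finset.prod_nonneg fun t _ => sub_nonneg.2 (hρ t).2
  cases o with
  | none => exact h _
  | some t => exact mul_nonneg (hρ t).1 (h _)

lemma sum_hazardWeight (ρ : Fin T → ℝ) : ∑ o, hazardWeight ρ o = 1 := by
  rw [Fintype.sum_option]
  simp only [hazardWeight]
  rw [Finset.prod_one_sub_ordered]
  ring

/-- The law of an execution with hazard rates `ρ`. -/
def ofHazard (ρ : Fin T → ℝ) (hρ : ∀ t, ρ t ∈ Set.Icc (0 : ℝ) 1) : PMF (Outcome T) :=
  PMF.ofFintype (fun o => ENNReal.ofReal (hazardWeight ρ o)) <| by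
    rw [← ENNReal.ofReal_sum_of_nonneg fun o _ => hazardWeight_nonneg hρ o, sum_hazardWeight,
      ENNReal.ofReal_one]

lemma haltProb_ofHazard (ρ : Fin T → ℝ) (hρ : ∀ t, ρ t ∈ Set.Icc (0 : ℝ) 1) (t : Fin T) :
    haltProb (ofHazard ρ hρ) t = ρ t * aliveProb (ofHazard ρ hρ) t := by
  have h : ∀ s, haltProb (ofHazard ρ hρ) s = ρ s * ∏ u with u < s, (1 - ρ u) := fun s => by
    rw [haltProb_eq]
    exact ENNReal.toReal_ofReal (hazardWeight_nonneg hρ (some s))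
  rw [aliveProb_eq, h, Finset.sum_congr rfl fun s _ => h s, Finset.prod_one_sub_ordered]
  congr 2
  refine Finset.sum_congr rfl fun s hs => ?_
  rw [Finset.filter_filter]
  congr 2
  ext u
  have hst : s < t := by simpa using hs
  simpa using fun h : u < s => h.trans hst

lemma ofHazard_some_congr {ρ ρ' : Fin T → ℝ} (hρ : ∀ t, ρ t ∈ Set.Icc (0 : ℝ) 1)
    (hρ' : ∀ t, ρ' t ∈ Set.Icc (0 : ℝ) 1) {t : Fin T} (h : ∀ s ≤ t, ρ s = ρ' s) :
    ofHazard ρ hρ (some t) = ofHazard ρ' hρ' (some t) := by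
  simp only [ofHazard, PMF.ofFintype_apply, hazardWeight]
  rw [h t le_rfl, Finset.prod_congr rfl fun s hs => by rw [h s (Finset.mem_filter.1 hs).2.le]]

/-! ### The first `k` elements of an infinite set of natural numbers -/

/-- The first `k` natural numbers satisfying `P`. -/
def firstOf (P : ℕ → Prop) (k : ℕ) : Finset ℕ := (Finset.range k).image (Nat.nth P)

section firstOf

variable {P P' : ℕ → Prop} [DecidablePred P] [DecidablePred P'] {k : ℕ}

lemma card_firstOf {P : ℕ → Prop} (hP : (Set.ofPred P).Infinite) : (firstOf P k).card = k := by
  rw [firstOf, Finset.card_image_of_injective _ (Nat.nth_injective hP), Finset.card_range]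

lemma mem_firstOf (hP : (Set.ofPred P).Infinite) {n : ℕ} :
    n ∈ firstOf P k ↔ P n ∧ Nat.count P n < k := by
  simp only [firstOf, Finset.mem_image, Finset.mem_range]
  constructor
  · rintro ⟨a, ha, rfl⟩
    exact ⟨Nat.nth_mem_of_infinite hP a, by rwa [Nat.count_nth_of_infinite hP]⟩
  · rintro ⟨h, hlt⟩
    exact ⟨_, hlt, Nat.nth_count h⟩

lemma count_congr_of_lt {n : ℕ} (h : ∀ m < n, (P m ↔ P' m)) : Nat.count P n = Nat.count P' n := by
  rw [Nat.count_eq_card_filter_range, Nat.count_eq_card_filter_range]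
  congr 1
  exact Finset.filter_congr fun m hm => h m (Finset.mem_range.1 hm)

lemma firstOf_filter_le_congr (hP : (Set.ofPred P).Infinite) (hP' : (Set.ofPred P').Infinite) {i : ℕ}
    (h : ∀ n ≤ i, (P n ↔ P' n)) :
    (firstOf P k).filter (· ≤ i) = (firstOf P' k).filter (· ≤ i) := by
  ext n
  simp only [Finset.mem_filter, mem_firstOf hP, mem_firstOf hP']
  refine and_congr_left fun hn => ?_
  rw [h n hn, count_congr_of_lt fun m hm => h m (hm.le.trans hn)]

lemma card_firstOf_filter_le (hP : (Set.ofPred P).Infinite) (i : ℕ) :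
    ((firstOf P k).filter (· ≤ i)).card ≤ Nat.count P (i + 1) := by
  rw [Nat.count_eq_card_filter_range]
  refine Finset.card_le_card fun n hn => ?_
  simp only [Finset.mem_filter, mem_firstOf hP, Finset.mem_range] at hn ⊢
  exact ⟨by omega, hn.1.1⟩

lemma firstOf_filter_le_eq_self (hP : (Set.ofPred P).Infinite) {i : ℕ} (h : k ≤ Nat.count P (i + 1)) :
    (firstOf P k).filter (· ≤ i) = firstOf P k := by
  refine Finset.filter_true_of_mem fun n hn => ?_
  by_contra hlt
  have := Nat.count_monotone P (show i + 1 ≤ n by omega)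
  have := ((mem_firstOf hP).1 hn).2
  omega

lemma firstOf_eq_of_subset (hP : (Set.ofPred P).Infinite) {J : Finset ℕ} (hJ : J.card = k)
    (hJP : ∀ n ∈ J, P n) (hPJ : ∀ n, P n → n ∉ J → ∀ m ∈ J, m < n) : firstOf P k = J := by
  refine (Finset.eq_of_subset_of_card_le (fun n hn => (mem_firstOf hP).2 ⟨hJP n hn, ?_⟩)
    (by rw [hJ, card_firstOf hP])).symm
  rw [Nat.count_eq_card_filter_range, ← hJ]
  refine Finset.card_lt_card ⟨fun m hm => ?_, fun hsub => by simpa using hsub hn⟩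
  simp only [Finset.mem_filter, Finset.mem_range] at hm
  by_contra hmJ
  exact absurd (hPJ m hm.2 hmJ n hn) (by omega)

/-- Adding `j` only raises counts, so every element other than `j` among the first `k` of `P'` was
already among the first `k` of `P`. Equal cardinality then leaves room for at most one exchange. -/
lemma firstOf_eq_or_replace {j : ℕ} (hP : (Set.ofPred P).Infinite)
    (h : ∀ n, P' n ↔ P n ∨ n = j) :
    firstOf P k = firstOf P' k ∨ ∃ (M : Finset ℕ) (a b : ℕ), a ∉ M ∧ b ∉ M ∧
      firstOf P k = insert a M ∧ firstOf P' k = insert b M := by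
  have hP' : (Set.ofPred P').Infinite := hP.mono fun n hn => (h n).2 (Or.inl hn)
  have hle : ∀ n, Nat.count P n ≤ Nat.count P' n := fun n => by
    rw [Nat.count_eq_card_filter_range, Nat.count_eq_card_filter_range]
    exact Finset.card_le_card (Finset.monotone_filter_right _ fun n _ hn => (h n).2 (Or.inl hn))
  have hsub : (firstOf P' k).erase j ⊆ firstOf P k := fun n hn => by
    obtain ⟨hnj, hn⟩ := Finset.mem_erase.1 hn
    obtain ⟨hn, hc⟩ := (mem_firstOf hP').1 hn
    exact (mem_firstOf hP).2 ⟨((h n).1 hn).resolve_right hnj, (hle n).trans_lt hc⟩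
  by_cases hmem : j ∈ firstOf P' k
  · right
    obtain ⟨a, ha, haM⟩ := Finset.exists_eq_insert_iff.2 ⟨hsub, by
      rw [Finset.card_erase_add_one hmem, card_firstOf hP, card_firstOf hP']⟩
    exact ⟨_, a, j, ha, Finset.notMem_erase _ _, haM.symm, (Finset.insert_erase hmem).symm⟩
  · left
    rw [Finset.erase_eq_of_notMem hmem] at hsub
    exact (Finset.eq_of_subset_of_card_le hsub (by rw [card_firstOf hP, card_firstOf hP'])).symm

end firstOf

/-! ### Points on which the threshold algorithm halts obliviously -/

/-- An increasing sequence of points of `(0, 1)`. -/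
def gridPoint (n : ℕ) : I :=
  ⟨((n : ℝ) + 1) / (n + 2), by positivity, (div_le_one (by positivity)).2 (by linarith)⟩

lemma gridPoint_pos (n : ℕ) : 0 < gridPoint n := by
  rw [← Subtype.coe_lt_coe]
  simp only [gridPoint]
  positivity

lemma gridPoint_strictMono : StrictMono gridPoint := fun m n h => by
  rw [← Subtype.coe_lt_coe]
  simp only [gridPoint]
  have h' : (m : ℝ) < n := Nat.cast_lt.2 h
  rw [div_lt_div_iff₀ (by positivity) (by positivity)]
  nlinarith

/-- The `min` only serves to make the set of colours finite; it is inactive on `[0, 1]`. -/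
lemma abs_sub_le_of_floor_eq {a b γ : ℝ} (hγ : 0 < γ) (ha : a ∈ Set.Icc (0 : ℝ) 1)
    (hb : b ∈ Set.Icc (0 : ℝ) 1)
    (h : min ⌊1 / γ⌋₊ ⌊a / γ⌋₊ = min ⌊1 / γ⌋₊ ⌊b / γ⌋₊) : |a - b| ≤ γ := by
  rw [min_eq_right (Nat.floor_mono (by gcongr; exact ha.2)),
    min_eq_right (Nat.floor_mono (by gcongr; exact hb.2))] at h
  have ha₁ := Nat.floor_le (div_nonneg ha.1 hγ.le)
  have hb₁ := Nat.floor_le (div_nonneg hb.1 hγ.le)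
  have ha₂ := Nat.lt_floor_add_one (a / γ)
  have hb₂ := Nat.lt_floor_add_one (b / γ)
  rw [h] at ha₁ ha₂
  have e : a - b = γ * (a / γ - b / γ) := by field_simp
  rw [e, abs_mul, abs_of_pos hγ]
  have : |a / γ - b / γ| ≤ 1 := abs_le.2 ⟨by linarith, by linarith⟩
  nlinarith

variable {k T : ℕ}

/-- The law of the transcript on a data set without repetitions. -/
def ThresholdAlg.law (A : ThresholdAlg k T) (q : Fin T →o I) (S : Finset I) : PMF (Outcome T) :=
  if h : S.card = k then A.run ⟨S.val, h⟩ q else PMF.pure none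

lemma ThresholdAlg.law_eq (A : ThresholdAlg k T) (q : Fin T →o I) {S : Finset I}
    (h : S.card = k) : A.law q S = A.run ⟨S.val, h⟩ q := dif_pos h

lemma ThresholdAlg.law_some_congr (A : ThresholdAlg k T) {q q' : Fin T →o I} {t : Fin T}
    (h : ∀ s ≤ t, q s = q' s) (S : Finset I) : A.law q S (some t) = A.law q' S (some t) := by
  unfold law
  split_ifs
  · exact A.online _ q q' t h
  · rfl

/-- The first `T` points of a sequence. -/
def queries (T : ℕ) (z : ℕ ↪o I) : Fin T ↪o I := (Fin.valOrderEmb T).trans z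

lemma ThresholdAlg.exists_oblivious_sequence (A : ThresholdAlg k T) {γ : ℝ} (hγ : 0 < γ) :
    ∃ z : ℕ ↪o I, (∀ n, 0 < z n) ∧ ∀ (i : Fin T) (J J' : Finset ℕ), J.card = k → J'.card = k →
      J.filter (· ≤ (i : ℕ)) = J'.filter (· ≤ (i : ℕ)) →
      |hazard (A.law (queries T z).toOrderHom (J.map z.toEmbedding)) i -
        hazard (A.law (queries T z).toOrderHom (J'.map z.toEmbedding)) i| ≤ γ := by
  -- The colouring must make sense for every `y`, so partial suprema force monotone queries. They
  -- still depend only on the prefix of `y`, and return `y` itself once it is increasing.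
  let q : (ℕ → ℕ) → (Fin T →o I) := fun y =>
    ⟨fun t => gridPoint (partialSups y t), fun s t h =>
      gridPoint_strictMono.monotone (partialSups_monotone y h)⟩
  let H : (ℕ → ℕ) → Fin T → Finset ℕ → ℝ := fun y i S => hazard (A.law (q y) (S.image gridPoint)) i
  let G : (ℕ → ℕ) → ℕ → Finset ℕ → Fin (⌊1 / γ⌋₊ + 1) := fun y i S =>
    if hi : i < T then ⟨min ⌊1 / γ⌋₊ ⌊H y ⟨i, hi⟩ S / γ⌋₊, Nat.lt_succ_of_le (min_le_left _ _)⟩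
    else 0
  obtain ⟨y, hy, hG⟩ := exists_strictMono_colour_eq k G fun y y' i hyy => by
    funext S
    by_cases hi : i < T
    · have hH : H y ⟨i, hi⟩ S = H y' ⟨i, hi⟩ S := by
        refine hazard_congr fun s hs => A.law_some_congr (fun u hu => ?_) _
        have hui : (u : ℕ) ≤ i := hu.trans hs
        simp only [q, OrderHom.coe_mk, partialSups_apply]
        congr 1
        exact Finset.sup'_congr _ rfl fun v hv => hyy v ((Finset.mem_Iic.1 hv).trans hui)
      simp only [G, hi, dite_true, hH]
    · simp [G, hi]
  have hz : StrictMono (gridPoint ∘ y) := gridPoint_strictMono.comp hy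
  refine ⟨OrderEmbedding.ofStrictMono _ hz, fun n => gridPoint_pos _, fun i J J' hJ hJ' h => ?_⟩
  have hq : (queries T (OrderEmbedding.ofStrictMono _ hz)).toOrderHom = q y := by
    ext t
    simp [queries, q, hy.monotone.partialSups_eq]
  have hmap : ∀ J : Finset ℕ, J.map (OrderEmbedding.ofStrictMono _ hz).toEmbedding =
      (J.image y).image gridPoint := fun J => by
    rw [Finset.image_image, Finset.map_eq_image]
    rfl
  rw [hq, hmap, hmap]
  have hc := hG i J J' hJ hJ' h
  simp only [G, i.2, dite_true, Fin.mk.injEq, Fin.eta] at hc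
  exact abs_sub_le_of_floor_eq hγ (hazard_mem_Icc _ _) (hazard_mem_Icc _ _) hc

/-! ### Data sets encoding update sequences -/

lemma ThresholdAlg.IsDP.law_insert {A : ThresholdAlg k T} {ε δ : ℝ} (hA : A.IsDP ε δ)
    (q : Fin T →o I) {M : Finset I} {a b : I} (ha : a ∉ M) (hb : b ∉ M)
    (hk : (insert a M).card = k) :
    DPClose ε δ (A.law q (insert a M)) (A.law q (insert b M)) := by
  have hk' : (insert b M).card = k := by
    rw [← hk, Finset.card_insert_of_notMem ha, Finset.card_insert_of_notMem hb]
  rw [A.law_eq q hk, A.law_eq q hk']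
  exact hA q _ _ ⟨M.val, a, b, Finset.insert_val_of_notMem ha, Finset.insert_val_of_notMem hb⟩

lemma rankBelow_mk (S : Finset I) (h : S.card = k) (z : I) :
    rankBelow (⟨S.val, h⟩ : Sym I k) z = (S.filter (· ≤ z)).card :=
  Multiset.countP_eq_card_filter _ _

/-- The rounds in which the update is `1`, with all rounds after the last one added. -/
def paddedOnes (Δ : Fin T → Bool) (n : ℕ) : Prop := ∀ h : n < T, Δ ⟨n, h⟩ = true

lemma infinite_of_forall_ge {P : ℕ → Prop} (h : ∀ n, T ≤ n → P n) : (Set.ofPred P).Infinite :=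
  (Set.Ici_infinite T).mono h

lemma infinite_paddedOnes (Δ : Fin T → Bool) : (Set.ofPred (paddedOnes Δ)).Infinite :=
  infinite_of_forall_ge fun _ hn h => absurd h (not_lt.2 hn)

/-- The first `k` ones of the update sequence, with padding after the last round. -/
def onesData (k : ℕ) (Δ : Fin T → Bool) : Finset ℕ := firstOf (paddedOnes Δ) k

lemma card_onesData (Δ : Fin T → Bool) : (onesData k Δ).card = k :=
  card_firstOf (infinite_paddedOnes Δ)

open Classical in
lemma count_paddedOnes (Δ : Fin T → Bool) (t : Fin T) :
    Nat.count (paddedOnes Δ) (t + 1) = (onesUpTo Δ t).card := by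
  rw [Nat.count_eq_card_filter_range]
  symm
  refine Finset.card_bij (fun s _ => (s : ℕ)) (fun s hs => ?_) (fun _ _ _ _ h => Fin.ext h)
    fun n hn => ?_
  · simp only [onesUpTo, Finset.mem_filter, Finset.mem_univ, true_and, Fin.le_def] at hs
    exact Finset.mem_filter.2 ⟨Finset.mem_range.2 (Nat.lt_succ_of_le hs.1), fun _ => hs.2⟩
  · simp only [Finset.mem_filter, Finset.mem_range, Nat.lt_succ_iff] at hn
    exact ⟨⟨n, hn.1.trans_lt t.2⟩,
      Finset.mem_filter.2 ⟨Finset.mem_univ _, Fin.le_def.2 hn.1, hn.2 _⟩, rfl⟩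

lemma ThresholdAlg.IsDP.law_onesData {A : ThresholdAlg k T} {ε δ : ℝ} (hA : A.IsDP ε δ)
    (hε : 0 ≤ ε) (hδ : 0 ≤ δ) (q : Fin T →o I) (z : ℕ ↪ I) {Δ Δ' : Fin T → Bool}
    (h : UpdatesAdjacent Δ Δ') :
    DPClose ε δ (A.law q ((onesData k Δ).map z)) (A.law q ((onesData k Δ').map z)) := by
  classical
  obtain ⟨j, hj⟩ := h
  have key : ∀ Δ Δ' : Fin T → Bool, (∀ i, i ≠ j → Δ i = Δ' i) → Δ j = false → Δ' j = true →
      onesData k Δ = onesData k Δ' ∨ ∃ (M : Finset ℕ) (a b : ℕ), a ∉ M ∧ b ∉ M ∧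
        onesData k Δ = insert a M ∧ onesData k Δ' = insert b M := by
    intro Δ Δ' hj h0 h1
    refine firstOf_eq_or_replace (j := j) (infinite_paddedOnes Δ) fun n => ?_
    rcases eq_or_ne n j with rfl | hn
    · simp [paddedOnes, h1]
    · simp only [paddedOnes, hn, or_false]
      exact forall_congr' fun h => by rw [hj ⟨n, h⟩ fun e => hn (congrArg Fin.val e)]
  have fin : ∀ Δ Δ' : Fin T → Bool, (onesData k Δ = onesData k Δ' ∨
      ∃ (M : Finset ℕ) (a b : ℕ), a ∉ M ∧ b ∉ M ∧
        onesData k Δ = insert a M ∧ onesData k Δ' = insert b M) →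
      DPClose ε δ (A.law q ((onesData k Δ).map z)) (A.law q ((onesData k Δ').map z)) := by
    rintro Δ Δ' (h | ⟨M, a, b, ha, hb, h, h'⟩)
    · rw [h]
      exact DPClose.rfl hε hδ _
    · have hk := card_onesData (k := k) Δ
      rw [h] at hk
      rw [h, h', Finset.map_insert, Finset.map_insert]
      refine hA.law_insert q (by simpa using ha) (by simpa using hb) ?_
      rw [← Finset.map_insert, Finset.card_map, hk]
  cases h0 : Δ j <;> cases h1 : Δ' j
  · exact fin _ _ (Or.inl (by rw [show Δ = Δ' from funext fun i =>
      (eq_or_ne i j).elim (fun e => by rw [e, h0, h1]) (hj i)]))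
  · exact fin _ _ (key _ _ hj h0 h1)
  -- `DPClose` is directional, but exchanging one point is a symmetric relation.
  · refine fin _ _ ((key Δ' Δ (fun i hi => (hj i hi).symm) h1 h0).imp Eq.symm ?_)
    rintro ⟨M, a, b, ha, hb, h, h'⟩
    exact ⟨M, b, a, hb, ha, h', h⟩
  · exact fin _ _ (Or.inl (by rw [show Δ = Δ' from funext fun i =>
      (eq_or_ne i j).elim (fun e => by rw [e, h0, h1]) (hj i)]))

lemma rankBelow_onesData (z : ℕ ↪o I) (Δ : Fin T → Bool) (t : Fin T)
    (h : ((onesData k Δ).map z.toEmbedding).card = k) :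
    rankBelow (⟨((onesData k Δ).map z.toEmbedding).val, h⟩ : Sym I k) (queries T z t) =
      ((onesData k Δ).filter (· ≤ (t : ℕ))).card := by
  rw [rankBelow_mk, Finset.filter_map, Finset.card_map]
  congr 1
  exact Finset.filter_congr fun n _ => z.le_iff_le

/-- Up to round `t` the data set holds no more points than there are ones, so a premature `⊤` is
also an error of `A`. After `k` ones no padding is used and all `k` points lie below the query, so a
late `⊥` is an error as well. -/
lemma monitorSucceeds_of_thresholdSucceeds (z : ℕ ↪o I) (Δ : Fin T → Bool)
    (h : ((onesData k Δ).map z.toEmbedding).card = k) {o : Outcome T}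
    (ho : ThresholdSucceeds (⟨((onesData k Δ).map z.toEmbedding).val, h⟩ : Sym I k)
      (queries T z).toOrderHom o) : MonitorSucceeds k Δ o := by
  classical
  intro t
  have hr := rankBelow_onesData z Δ t h
  have hc := count_paddedOnes Δ t
  refine ⟨fun ht hlt => (ho t).1 ht ?_, fun ht hle => (ho t).2 ht ?_⟩
  · refine le_trans ?_ hlt.le
    rw [Nat.cast_le, ← hc]
    exact hr.trans_le (card_firstOf_filter_le (infinite_paddedOnes Δ) t)
  · refine le_of_eq (Eq.trans ?_ hr.symm)
    rw [← hc] at hle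
    rw [onesData, firstOf_filter_le_eq_self (infinite_paddedOnes Δ) hle,
      card_firstOf (infinite_paddedOnes Δ)]

/-! ### The monitor -/

/-- The indices of the points in `D`, with all indices from `T` on added. -/
def paddedIndex (T : ℕ) (z : ℕ ↪o I) (D : Finset I) (n : ℕ) : Prop := T ≤ n ∨ z n ∈ D

/-- The conditional halting probabilities of `A` on the data set `D` padded to size `k`. -/
def ThresholdAlg.rate (A : ThresholdAlg k T) (z : ℕ ↪o I) (i : Fin T) (D : Finset I) : ℝ :=
  hazard (A.law (queries T z).toOrderHom ((firstOf (paddedIndex T z D) k).map z.toEmbedding)) i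

/-- The monitor that, in round `i`, halts at the rate of `A` on the points of the rounds so far
whose update is `1`. -/
def ThresholdAlg.monitor (A : ThresholdAlg k T) (z : ℕ ↪o I) : MonitorAlg T where
  run Δ := ofHazard (fun i => A.rate z i ((onesUpTo Δ i).map (queries T z).toEmbedding))
    fun _ => hazard_mem_Icc _ _
  online Δ Δ' t h := ofHazard_some_congr _ _ fun s hs => by
    rw [show onesUpTo Δ s = onesUpTo Δ' s from
      Finset.filter_congr fun j _ => and_congr_right fun hj => by rw [h j (hj.trans hs)]]

lemma ThresholdAlg.rate_mem_Icc (A : ThresholdAlg k T) (z : ℕ ↪o I) (i : Fin T) (D : Finset I) :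
    A.rate z i D ∈ Set.Icc (0 : ℝ) 1 := hazard_mem_Icc _ _

lemma ThresholdAlg.haltProb_monitor (A : ThresholdAlg k T) (z : ℕ ↪o I) (Δ : Fin T → Bool)
    (i : Fin T) : haltProb ((A.monitor z).run Δ) i =
      A.rate z i ((onesUpTo Δ i).map (queries T z).toEmbedding) *
        aliveProb ((A.monitor z).run Δ) i :=
  haltProb_ofHazard _ (fun _ => A.rate_mem_Icc z _ _) i

/-- The monitor's set omits ones in rounds after `i`, which it has not yet seen. Agreement up to `i`
is all that obliviousness requires. -/
lemma onesData_filter_le (z : ℕ ↪o I) (Δ : Fin T → Bool) (i : Fin T) :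
    (firstOf (paddedIndex T z ((onesUpTo Δ i).map (queries T z).toEmbedding)) k).filter
      (· ≤ (i : ℕ)) = (onesData k Δ).filter (· ≤ (i : ℕ)) := by
  classical
  refine firstOf_filter_le_congr (infinite_of_forall_ge fun n hn => Or.inl hn)
    (infinite_paddedOnes Δ) fun n hn => ?_
  have hnT : n < T := hn.trans_lt i.2
  have hmem : z n ∈ (onesUpTo Δ i).map (queries T z).toEmbedding ↔
      (⟨n, hnT⟩ : Fin T) ∈ onesUpTo Δ i :=
    Finset.mem_map' (queries T z).toEmbedding (a := ⟨n, hnT⟩)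
  have hni : (⟨n, hnT⟩ : Fin T) ≤ i := hn
  change T ≤ n ∨ z n ∈ _ ↔ _
  rw [hmem, onesUpTo, Finset.mem_filter]
  constructor
  · rintro (h | h) h'
    · exact absurd h hnT.not_ge
    · exact h.2.2
  · exact fun h => Or.inr ⟨Finset.mem_univ _, hni, h hnT⟩

/-- For the indicator sequence of a set of exactly `k` points, truncation and padding do nothing.
Hence the hazard estimate for update sequences also covers all data sets in `HaltsObliviously`. -/
lemma exists_onesData_map_eq (z : ℕ ↪o I) {S : Finset I} (hS : S.card = k)
    (hSx : (S : Set I) ⊆ Set.range (queries T z)) :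
    ∃ Δ : Fin T → Bool, (onesData k Δ).map z.toEmbedding = S ∧
      ∀ i, (onesUpTo Δ i).map (queries T z).toEmbedding = S.filter (· ≤ queries T z i) := by
  classical
  let Δ : Fin T → Bool := fun j => decide (queries T z j ∈ S)
  let F : Finset (Fin T) := Finset.univ.filter fun j => queries T z j ∈ S
  have hF : F.map (queries T z).toEmbedding = S := by
    ext a
    simp only [F, Finset.mem_map, Finset.mem_filter, Finset.mem_univ, true_and]
    constructor
    · rintro ⟨j, hj, rfl⟩
      exact hj
    · intro ha
      obtain ⟨j, rfl⟩ := hSx ha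
      exact ⟨j, ha, rfl⟩
  have hJ : onesData k Δ = F.map (Fin.valOrderEmb T).toEmbedding := by
    refine firstOf_eq_of_subset (infinite_paddedOnes Δ) ?_ ?_ ?_
    · rw [Finset.card_map, ← hS, ← hF, Finset.card_map]
    · intro n hn _
      obtain ⟨j, hj, rfl⟩ := Finset.mem_map.1 hn
      exact decide_eq_true (Finset.mem_filter.1 hj).2
    · intro n hn hnF m hm
      obtain ⟨j, -, rfl⟩ := Finset.mem_map.1 hm
      refine j.2.trans_le (not_lt.1 fun hnT => hnF ?_)
      exact Finset.mem_map.2 ⟨⟨n, hnT⟩,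
        Finset.mem_filter.2 ⟨Finset.mem_univ _, of_decide_eq_true (hn hnT)⟩, rfl⟩
  refine ⟨Δ, ?_, fun i => ?_⟩
  · rw [hJ, Finset.map_map]
    exact hF
  · conv_rhs => rw [← hF]
    rw [Finset.filter_map, Finset.filter_filter]
    congr 1
    refine Finset.filter_congr fun j _ => ?_
    simp only [Δ, decide_eq_true_eq]
    exact and_comm.trans (and_congr_right fun _ => (queries T z).le_iff_le.symm)

theorem ThresholdAlg.exists_oblivious_monitor {ε δ β : ℝ} (hε : 0 ≤ ε) (hδ : 0 ≤ δ)
    (A : ThresholdAlg k T) (hDP : A.IsDP ε δ) (hfail : A.FailsAtMost β)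
    {η : ℝ} (hη : 0 < η) :
    ∃ (x : Fin T ↪o I) (r : Fin T → Finset I → ℝ),
      (∀ i, 0 < x i) ∧
      HaltsObliviously A η x r ∧
      ∃ B : MonitorAlg T,
        HaltsAccordingTo B k x r ∧
        B.IsDP ε (δ + T * η) ∧
        B.FailsAtMost k (β + T * η) := by
  have hexp := Real.exp_pos ε
  -- Replacing the laws of `A` by those of the monitor costs `2Tγ` on the left of the privacy
  -- inequality and `exp ε` times that on the right; this choice of `γ` makes the total `T * η`.
  have hγ : 0 < η / (2 * (1 + Real.exp ε)) := by positivity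
  obtain ⟨γ, hγ_def⟩ : ∃ γ, γ = η / (2 * (1 + Real.exp ε)) := ⟨_, rfl⟩
  rw [← hγ_def] at hγ
  have hγη : 2 * γ * (1 + Real.exp ε) = η := by
    rw [hγ_def]
    field_simp
  have h2γ : 2 * γ ≤ η := by nlinarith
  obtain ⟨z, hz, hobl⟩ := A.exists_oblivious_sequence hγ
  have hrate : ∀ (Δ : Fin T → Bool) (i : Fin T),
      |A.rate z i ((onesUpTo Δ i).map (queries T z).toEmbedding) -
        hazard (A.law (queries T z).toOrderHom ((onesData k Δ).map z.toEmbedding)) i| ≤ γ :=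
    fun Δ i => hobl i _ _ (card_firstOf (infinite_of_forall_ge fun n hn => Or.inl hn))
      (card_onesData Δ) (onesData_filter_le z Δ i)
  have hclose : ∀ (Δ : Fin T → Bool) (E : Set (Outcome T)),
      |prob ((A.monitor z).run Δ) E -
        prob (A.law (queries T z).toOrderHom ((onesData k Δ).map z.toEmbedding)) E| ≤
        T * (2 * γ) := fun Δ E =>
    abs_prob_sub_le_of_hazard (fun _ => A.rate_mem_Icc z _ _)
      (fun i => abs_haltProb_sub_le (hrate Δ i)) (A.haltProb_monitor z Δ) E
  have hcard : ∀ Δ : Fin T → Bool, ((onesData k Δ).map z.toEmbedding).card = k := fun Δ => by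
    rw [Finset.card_map, card_onesData]
  refine ⟨queries T z, A.rate z, fun i => hz i,
    ⟨A.rate_mem_Icc z, fun S hS hSx i _ => ?_⟩, A.monitor z,
    fun Δ i _ => A.haltProb_monitor z Δ i, fun Δ Δ' hadj => ?_, fun Δ => ?_⟩
  · obtain ⟨Δ, hΔ, hΔi⟩ := exists_onesData_map_eq z hS hSx
    have h := hrate Δ i
    rw [hΔ, hΔi, A.law_eq _ hS] at h
    exact h.trans (by linarith)
  · have h := (hDP.law_onesData hε hδ (queries T z).toOrderHom z.toEmbedding
      hadj).of_abs_sub_le (hclose Δ) (hclose Δ')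
    rwa [mul_assoc, hγη] at h
  · have h₁ := (abs_le.1 (hclose Δ {o | ¬ MonitorSucceeds k Δ o})).2
    have h₂ := prob_mono (A.law (queries T z).toOrderHom ((onesData k Δ).map z.toEmbedding))
      (E := {o | ¬ MonitorSucceeds k Δ o})
      (F := {o | ¬ ThresholdSucceeds
        (⟨((onesData k Δ).map z.toEmbedding).val, hcard Δ⟩ : Sym I k) (queries T z).toOrderHom o})
      fun o ho hs => ho (monitorSucceeds_of_thresholdSucceeds z Δ (hcard Δ) hs)
    have h₃ := hfail ⟨((onesData k Δ).map z.toEmbedding).val, hcard Δ⟩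
      (queries T z).toOrderHom
    rw [← A.law_eq _ (hcard Δ)] at h₃
    have h₄ : (T : ℝ) * (2 * γ) ≤ T * η := by gcongr
    linarith

end OnlineThreshold

end

theorem mainTheorem6 {k T : ℕ} (ε δ β : ℝ) (hε : 0 ≤ ε) (hδ : 0 ≤ δ)
    (A : OnlineThreshold.ThresholdAlg k T) (hDP : A.IsDP ε δ) (hfail : A.FailsAtMost β)
    (η : ℝ) (hη : 0 < η) :
    ∃ (x : Fin T ↪o unitInterval) (r : Fin T → Finset unitInterval → ℝ),
      (∀ i, 0 < x i) ∧
      OnlineThreshold.HaltsObliviously A η x r ∧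
      ∃ B : OnlineThreshold.MonitorAlg T,
        OnlineThreshold.HaltsAccordingTo B k x r ∧
        B.IsDP ε (δ + T * η) ∧
        B.FailsAtMost k (β + T * η) :=
  OnlineThreshold.ThresholdAlg.exists_oblivious_monitor hε hδ A hDP hfail hη
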